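/- Let $U$ be a unitary $2\times 2$ matrix. For a unitary $V$ let $\mathcal{P}_V$ be the von Neumann measurement whose $i$-th effect is the projector onto the $i$-th column of $V$, regarded as the channel $\mathcal{P}_V(\sigma)=\sum_{i=1}^{2}\langle i|V^\dagger\sigma V|i\rangle\,|i\rangle\langle i|$. Given two states $\rho_1,\rho_2$, a three-outcome POVM $(M_1,M_2,M_?)$ discriminates them unambiguously if $\operatorname{tr}(M_2\rho_1)=\operatorname{tr}(M_1\rho_2)=0$, and its success probability, for equal a priori probabilities, is $\frac12\left(\operatorname{tr}(M_1\rho_1)+\operatorname{tr}(M_2\rho_2)\right)$. Let $p_u$ be the maximum of this success probability over all states $\sigma$ on $\mathbb{C}^2$ and all POVMs on $\mathbb{C}^2$ that unambiguously discriminate $\rho_1=\mathcal{P}_{1}(\sigma)$ and $\rho_2=\mathcal{P}_U(\sigma)$, where $\mathcal{P}_1$ is the measurement in the standard basis ($V$ is the identity matrix). Let $p_u^e$ be the maximum of the success probability over all finite ancilla dimensions $d'$, all states $\sigma$ on $\mathbb{C}^2\otimes\mathbb{C}^{d'}$ and all POVMs on $\mathbb{C}^2\otimes\mathbb{C}^{d'}$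 that unambiguously discriminate $\rho_1=(\mathcal{P}_1\otimes\mathrm{id})(\sigma)$ and $\rho_2=(\mathcal{P}_U\otimes\mathrm{id})(\sigma)$. Then both maxima are attained, and $$p_u=\begin{cases}1 & \text{if } |U_{12}|^2=1,\\ \tfrac12|U_{12}|^2 & \text{if } |U_{12}|^2<1.\end{cases}$$ If $|U_{11}|\notin\{0,1\}$, then $p_u^e=1-|U_{11}|$ and $p_u^e>p_u$. If $|U_{11}|\in\{0,1\}$, then $p_u^e=p_u$. -/

import Mathlib

namespace UnambiguousDiscrimination

open scoped ComplexOrder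

/-- Quantum states (density operators) on the Hilbert space with orthonormal basis `n`. -/
def IsDensity {n : Type*} [Fintype n] (ρ : Matrix n n ℂ) : Prop :=
  ρ.PosSemidef ∧ ρ.trace = 1

/-- A generalized measurement with outcomes `ι`: positive semidefinite effects
that add up to the identity. -/
structure POVM (ι n : Type*) [Fintype ι] [Fintype n] [DecidableEq n] where
  effect : ι → Matrix n n ℂ
  posSemidef : ∀ i, (effect i).PosSemidef
  sum_effect : ∑ i, effect i = 1

/-- The measure-and-prepare channel `σ ↦ ∑ i, tr (M_i σ) |i⟩⟨i|` of a measurement. -/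
noncomputable def POVM.channel {ι n : Type*} [Fintype ι] [DecidableEq ι] [Fintype n]
    [DecidableEq n] (M : POVM ι n) : Matrix n n ℂ →ₗ[ℂ] Matrix ι ι ℂ where
  toFun σ := ∑ i, (M.effect i * σ).trace • Matrix.single i i (1 : ℂ)
  map_add' σ τ := by
    simp only [Matrix.mul_add, Matrix.trace_add, add_smul, Finset.sum_add_distrib]
  map_smul' c σ := by
    simp only [Matrix.mul_smul, Matrix.trace_smul, smul_eq_mul, mul_smul, Finset.smul_sum,
      RingHom.id_apply]

/-- The von Neumann measurement `P_U`: the `i`-th effect is the projector `|ψ_i⟩⟨ψ_i|`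
on the `i`-th column `ψ_i = U |i⟩` of the unitary `U`. -/
def vonNeumann {n : Type*} [Fintype n] [DecidableEq n] (U : Matrix.unitaryGroup n ℂ) :
    POVM n n where
  effect i := Matrix.vecMulVec (fun k => U.1 k i) (star fun k => U.1 k i)
  posSemidef i := Matrix.posSemidef_vecMulVec_self_star _
  sum_effect := by
    have h : U.1 * star U.1 = 1 := Matrix.mem_unitaryGroup_iff.mp U.2
    rw [← h]
    ext k l
    simp [Matrix.sum_apply, Matrix.vecMulVec_apply, Matrix.mul_apply, Matrix.star_apply]

/-- The linear map `Φ ⊗ id` on operators on a system extended by an ancilla with basis `b`: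
`Φ` is applied to each block `⟨β| σ |β'⟩`. -/
def withAncilla {m n : Type*} (b : Type*) (Φ : Matrix n n ℂ →ₗ[ℂ] Matrix m m ℂ)
    (σ : Matrix (n × b) (n × b) ℂ) : Matrix (m × b) (m × b) ℂ :=
  Matrix.of fun x y => Φ (Matrix.of fun k l => σ (k, x.2) (l, y.2)) x.1 y.1

/-- `M` discriminates the two states unambiguously. Outcome `0` is the answer "`ρ₁`",
outcome `1` is the answer "`ρ₂`", outcome `2` is inconclusive. -/
def IsUnambiguous {n : Type*} [Fintype n] [DecidableEq n] (ρ₁ ρ₂ : Matrix n n ℂ)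
    (M : POVM (Fin 3) n) : Prop :=
  (M.effect 1 * ρ₁).trace = 0 ∧ (M.effect 0 * ρ₂).trace = 0

/-- The probability of the correct conclusive answer, for equal a priori probabilities. -/
noncomputable def successProb {n : Type*} [Fintype n] [DecidableEq n] (ρ₁ ρ₂ : Matrix n n ℂ)
    (M : POVM (Fin 3) n) : ℝ :=
  1 / 2 * ((M.effect 0 * ρ₁).trace.re + (M.effect 1 * ρ₂).trace.re)

/-- Success probabilities of the unambiguous strategies for two measurements that use
no entanglement. -/
def strategyValues {ι n : Type*} [Fintype ι] [DecidableEq ι] [Fintype n] [DecidableEq n]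
    (P Q : POVM ι n) : Set ℝ :=
  {p | ∃ σ : Matrix n n ℂ, IsDensity σ ∧ ∃ M : POVM (Fin 3) ι,
    IsUnambiguous (P.channel σ) (Q.channel σ) M ∧
    p = successProb (P.channel σ) (Q.channel σ) M}

/-- Success probabilities of the unambiguous strategies for two measurements that use an
ancilla of an arbitrary finite dimension `d'`. -/
def assistedStrategyValues {ι n : Type*} [Fintype ι] [DecidableEq ι] [Fintype n]
    [DecidableEq n] (P Q : POVM ι n) : Set ℝ :=
  {p | ∃ d' : ℕ, ∃ σ : Matrix (n × Fin d') (n × Fin d') ℂ, IsDensity σ ∧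
    ∃ M : POVM (Fin 3) (ι × Fin d'),
      IsUnambiguous (withAncilla (Fin d') P.channel σ) (withAncilla (Fin d') Q.channel σ) M ∧
      p = successProb (withAncilla (Fin d') P.channel σ) (withAncilla (Fin d') Q.channel σ) M}

/-- The optimal success probability without the assistance of entanglement. -/
noncomputable def optProb {ι n : Type*} [Fintype ι] [DecidableEq ι] [Fintype n]
    [DecidableEq n] (P Q : POVM ι n) : ℝ :=
  sSup (strategyValues P Q)

/-- The optimal entanglement-assisted success probability. -/
noncomputable def optProbAssisted {ι n : Type*} [Fintype ι] [DecidableEq ι] [Fintype n]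
    [DecidableEq n] (P Q : POVM ι n) : ℝ :=
  sSup (assistedStrategyValues P Q)

end UnambiguousDiscrimination

namespace UnambiguousDiscrimination

open scoped ComplexOrder Matrix
open Matrix

/-! ### Unitary matrices of size two -/

section UnitaryTwo

variable (U : Matrix.unitaryGroup (Fin 2) ℂ)

/-! Write `a = |U₁₁|`, `s = |U₁₂|² = 1 - a²`, and let `u_i` be the columns of `U`.

With an ancilla, factor `σ = B Bᴴ`. Outcome `i` leaves the ancilla with `X_i = ⟨i|B` under the first
measurement and `Y_i = ⟨u_i|B` under the second, so each outcome poses its own unambiguous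
discrimination problem. Positivity of the inconclusive effect on `X_i - φ_i Y_i` bounds the success
there (`unambiguous_pair_le`). In the sum over `i` the cross terms form `tr (Bᴴ (W ⊗ 1) B)` with `W
= diag(φ) Uᴴ`. The phases of `exists_column_phases` give `W` the Hermitian part `a • 1`, whence the
bound `1 - a` for every `σ`. A Bell state attains it.

Without an ancilla only two distributions `p`, `q` on two points remain, and a point is informative
only where one of them vanishes. Such a zero forces the input to be a basis vector and the other
probability to be `s`. If `s < 1`, at most one point is informative, which gives `s / 2`
(`classical_unambiguous_le`). -/

theorem unitary_col_mul (i j : Fin 2) :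
    star (U.1 0 i) * U.1 0 j + star (U.1 1 i) * U.1 1 j = if i = j then 1 else 0 := by
  have h := congrFun (congrFun (Matrix.mem_unitaryGroup_iff'.mp U.2) i) j
  simpa [Matrix.mul_apply, Fin.sum_univ_two, Matrix.one_apply] using h

theorem unitary_row_mul (i j : Fin 2) :
    U.1 i 0 * star (U.1 j 0) + U.1 i 1 * star (U.1 j 1) = if i = j then 1 else 0 := by
  have h := congrFun (congrFun (Matrix.mem_unitaryGroup_iff.mp U.2) i) j
  simpa [Matrix.mul_apply, Fin.sum_univ_two, Matrix.one_apply] using h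

theorem star_mul_self_eq_norm_sq (z : ℂ) : star z * z = ((‖z‖ ^ 2 : ℝ) : ℂ) := by
  rw [← Complex.normSq_eq_norm_sq, Complex.star_def, Complex.normSq_eq_conj_mul_self]

theorem mul_star_self_eq_norm_sq (z : ℂ) : z * star z = ((‖z‖ ^ 2 : ℝ) : ℂ) := by
  rw [mul_comm, star_mul_self_eq_norm_sq]

theorem unitary_col_norm (i : Fin 2) : ‖U.1 0 i‖ ^ 2 + ‖U.1 1 i‖ ^ 2 = 1 := by
  have h := unitary_col_mul U i i
  simp only [star_mul_self_eq_norm_sq, if_true] at h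
  exact_mod_cast h

theorem unitary_row_norm (i : Fin 2) : ‖U.1 i 0‖ ^ 2 + ‖U.1 i 1‖ ^ 2 = 1 := by
  have h := unitary_row_mul U i i
  simp only [mul_star_self_eq_norm_sq, if_true] at h
  exact_mod_cast h

theorem norm_zero_one_sq : ‖U.1 0 1‖ ^ 2 = 1 - ‖U.1 0 0‖ ^ 2 := by
  linarith [unitary_row_norm U 0]

theorem norm_one_zero_sq : ‖U.1 1 0‖ ^ 2 = 1 - ‖U.1 0 0‖ ^ 2 := by
  linarith [unitary_col_norm U 0]

theorem norm_diag (i : Fin 2) : ‖U.1 i i‖ = ‖U.1 0 0‖ := by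
  have h : ‖U.1 i i‖ ^ 2 = ‖U.1 0 0‖ ^ 2 := by
    fin_cases i
    · rfl
    · have := unitary_row_norm U 0
      have := unitary_col_norm U 1
      simp only [Fin.mk_one]
      linarith
  exact (pow_left_inj₀ (norm_nonneg _) (norm_nonneg _) two_ne_zero).mp h

theorem norm_zero_zero_le_one : ‖U.1 0 0‖ ≤ 1 := by
  nlinarith [unitary_row_norm U 0, sq_nonneg ‖U.1 0 1‖, norm_nonneg (U.1 0 0)]

theorem exists_phase (z : ℂ) : ∃ φ : ℂ, ‖φ‖ = 1 ∧ φ * star z = (‖z‖ : ℂ) := by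
  by_cases hz : z = 0
  · exact ⟨1, by simp, by simp [hz]⟩
  · have hn : (‖z‖ : ℂ) ≠ 0 := by exact_mod_cast norm_ne_zero_iff.mpr hz
    refine ⟨z / (‖z‖ : ℂ), ?_, ?_⟩
    · rw [norm_div, Complex.norm_real, norm_norm, div_self (norm_ne_zero_iff.mpr hz)]
    · rw [div_mul_eq_mul_div, mul_star_self_eq_norm_sq, div_eq_iff hn]
      push_cast; ring

/-- Multiplying the columns of a unitary by suitable phases makes the diagonal constant and
nonnegative and the off-diagonal part skew-Hermitian. -/
theorem exists_column_phases : ∃ φ : Fin 2 → ℂ, (∀ i, ‖φ i‖ = 1) ∧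
    (∀ i, φ i * star (U.1 i i) = (‖U.1 0 0‖ : ℂ)) ∧
    φ 1 * star (U.1 0 1) = -star (φ 0 * star (U.1 1 0)) := by
  obtain ⟨φ, hφ, hz⟩ := exists_phase (U.1 0 0)
  set e : ℂ := U.1 0 0 * U.1 1 1 - U.1 0 1 * U.1 1 0 with he
  have c00 := unitary_col_mul U 0 0
  have c01 := unitary_col_mul U 0 1
  have c10 := unitary_col_mul U 1 0
  have c11 := unitary_col_mul U 1 1
  simp only [if_true, Fin.isValue, zero_ne_one, one_ne_zero, if_false] at c00 c01 c10 c11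
  -- `e` is the determinant; this and `h01` are entries of `e • Uᴴ = adj U`.
  have h11 : e * star (U.1 1 1) = U.1 0 0 := by
    rw [he]; linear_combination U.1 0 0 * c11 - U.1 0 1 * c10
  have h01 : e * star (U.1 0 1) = -U.1 1 0 := by
    rw [he]; linear_combination -U.1 1 0 * c11 + U.1 1 1 * c10
  have hdet : ‖e‖ = 1 := by
    have h : e * star e = 1 := by
      have : star e = star (U.1 0 0) * star (U.1 1 1) - star (U.1 0 1) * star (U.1 1 0) := by
        rw [he]; simp
      rw [this]
      linear_combination star (U.1 0 0) * h11 - star (U.1 1 0) * h01 + c00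
    rw [mul_star_self_eq_norm_sq] at h
    have h' : ‖e‖ ^ 2 = 1 := by exact_mod_cast h
    exact (pow_eq_one_iff_of_nonneg (norm_nonneg _) two_ne_zero).mp h'
  -- The second phase is forced up to the determinant: `e * star (U 1 1) = U 0 0`, and `star φ`
  -- rotates `U 0 0` to its norm.
  refine ⟨![φ, e * star φ], ?_, ?_, ?_⟩
  · intro i; fin_cases i <;> simp [hφ, hdet]
  · intro i
    fin_cases i
    · simpa using hz
    · have hz' := congrArg star hz
      simp only [star_mul', Complex.star_def, Complex.conj_conj, Complex.conj_ofReal] at hz' h11 ⊢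
      simp only [Fin.mk_one, Matrix.cons_val_one, Matrix.cons_val_fin_one]
      linear_combination (starRingEnd ℂ) φ * h11 + hz'
  · simp only [Matrix.cons_val_one, Matrix.cons_val_zero, Matrix.cons_val_fin_one, star_mul',
      star_star]
    linear_combination star φ * h01

end UnitaryTwo

/-! ### Unambiguous discrimination of two vectors -/

section Pure

variable {m n : Type*} [Fintype m] [Fintype n]

theorem _root_.Matrix.PosSemidef.exists_eq_mul_conjTranspose {σ : Matrix n n ℂ}
    (h : σ.PosSemidef) : ∃ (k : ℕ) (B : Matrix n (Fin k) ℂ), σ = B * Bᴴ := by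
  obtain ⟨k, v, hv⟩ := Matrix.posSemidef_iff_eq_sum_vecMulVec.mp h
  refine ⟨k, Matrix.of fun i j => v j i, ?_⟩
  rw [hv]
  ext i j
  simp [Matrix.sum_apply, Matrix.vecMulVec_apply, Matrix.mul_apply]

theorem _root_.Matrix.PosSemidef.mul_eq_zero_of_trace_eq_zero {N : Matrix n n ℂ}
    (hN : N.PosSemidef) {X : Matrix n m ℂ} (h : (Xᴴ * N * X).trace = 0) : N * X = 0 := by
  obtain ⟨k, B, rfl⟩ := hN.exists_eq_mul_conjTranspose
  have h' : ((Bᴴ * X)ᴴ * (Bᴴ * X)).trace = 0 := by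
    rw [← h]; simp [Matrix.mul_assoc]
  rw [Matrix.mul_assoc, Matrix.trace_conjTranspose_mul_self_eq_zero_iff.mp h', Matrix.mul_zero]

/-- Unambiguity gives `N 1 * X = 0` and `N 0 * Y = 0`, so the cross terms of `N 2 = 1 - N 0 - N 1`
between `X` and `Y` are those of the identity. Testing `N 2 ≥ 0` on `X - φ • Y` yields the bound;
`φ` is left free so that the phases can be matched across outcomes. -/
theorem unambiguous_pair_le [DecidableEq n] (N : Fin 3 → Matrix n n ℂ)
    (hN : ∀ k, (N k).PosSemidef) (hsum : ∑ k, N k = 1) (X Y : Matrix n m ℂ) {φ : ℂ}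
    (hφ : ‖φ‖ = 1) (hX : (Xᴴ * N 1 * X).trace = 0) (hY : (Yᴴ * N 0 * Y).trace = 0) :
    (Xᴴ * N 0 * X).trace.re + (Yᴴ * N 1 * Y).trace.re ≤
      (Xᴴ * X).trace.re + (Yᴴ * Y).trace.re - 2 * (φ * (Xᴴ * Y).trace).re := by
  have hX' := (hN 1).mul_eq_zero_of_trace_eq_zero hX
  have hY' := (hN 0).mul_eq_zero_of_trace_eq_zero hY
  have hX'' : Xᴴ * N 1 = 0 := by
    have := congrArg Matrix.conjTranspose hX'
    rwa [Matrix.conjTranspose_mul, (hN 1).isHermitian.eq, Matrix.conjTranspose_zero] at this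
  have hY'' : Yᴴ * N 0 = 0 := by
    have := congrArg Matrix.conjTranspose hY'
    rwa [Matrix.conjTranspose_mul, (hN 0).isHermitian.eq, Matrix.conjTranspose_zero] at this
  have h2 : N 2 = 1 - N 0 - N 1 := by
    rw [← hsum, Fin.sum_univ_three]; abel
  have hφ' : star φ * φ = 1 := by rw [star_mul_self_eq_norm_sq, hφ]; simp
  have key := ((hN 2).conjTranspose_mul_mul_same (X - φ • Y)).trace_nonneg
  have hexp : ((X - φ • Y)ᴴ * N 2 * (X - φ • Y)).trace =
      (Xᴴ * X).trace - (Xᴴ * N 0 * X).trace + (Yᴴ * Y).trace - (Yᴴ * N 1 * Y).trace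
        - φ * (Xᴴ * Y).trace - star (φ * (Xᴴ * Y).trace) := by
    have hs : star (Xᴴ * Y).trace = (Yᴴ * X).trace := by
      rw [← Matrix.trace_conjTranspose]; simp
    rw [star_mul', hs, h2]
    simp only [Matrix.conjTranspose_sub, Matrix.conjTranspose_smul, Matrix.sub_mul, Matrix.mul_sub,
      Matrix.smul_mul, Matrix.mul_smul, Matrix.mul_one, Matrix.trace_sub, Matrix.trace_smul,
      smul_sub, smul_eq_mul, hX'', hY'', Matrix.zero_mul, Matrix.mul_assoc, hX', hY',
      Matrix.mul_zero, Matrix.trace_zero, smul_zero]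
    linear_combination ((Yᴴ * Y).trace - (Yᴴ * (N 1 * Y)).trace) * hφ'
  rw [hexp] at key
  have := (Complex.nonneg_iff.mp key).1
  simp only [Complex.sub_re, Complex.add_re, Complex.star_def, Complex.conj_re] at this
  linarith

end Pure

/-! ### The entanglement-assisted scheme -/

section Assisted

variable {b m : Type*}

/-- The compression `⟨v_i| B` of a matrix `B` by the `i`-th column `v_i` of `V`, acting on the
first tensor factor. -/
def columnSlice {n : Type*} [Fintype n] (V : Matrix n n ℂ) (B : Matrix (n × b) m ℂ) (i : n) :
    Matrix b m ℂ :=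
  Matrix.of fun β μ => ∑ l, star (V l i) * B (l, β) μ

/-- The diagonal block of `E` at position `i` of the first tensor factor. -/
def diagBlock {n : Type*} (E : Matrix (n × b) (n × b) ℂ) (i : n) : Matrix b b ℂ :=
  E.submatrix (Prod.mk i) (Prod.mk i)

theorem vonNeumann_channel_apply {n : Type*} [Fintype n] [DecidableEq n]
    (V : Matrix.unitaryGroup n ℂ) (σ : Matrix n n ℂ) (i j : n) :
    (vonNeumann V).channel σ i j = if i = j then (star V.1 * σ * V.1) i i else 0 := by
  have h (k : n) : ((vonNeumann V).effect k * σ).trace = (star V.1 * σ * V.1) k k := by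
    simp only [vonNeumann, Matrix.vecMulVec_mul, Matrix.trace_vecMulVec, dotProduct,
      Matrix.vecMul, Matrix.mul_apply, Matrix.star_apply, Pi.star_apply]
    exact Finset.sum_congr rfl fun x _ => mul_comm _ _
  simp only [POVM.channel, LinearMap.coe_mk, AddHom.coe_mk, Matrix.sum_apply, Matrix.smul_apply,
    h, Matrix.single_apply, smul_eq_mul, mul_ite, mul_one, mul_zero]
  by_cases hij : i = j
  · subst hij; simp
  · rw [if_neg hij]
    refine Finset.sum_eq_zero fun k _ => if_neg ?_
    rintro ⟨rfl, rfl⟩; exact hij rfl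

theorem columnSlice_two (V : Matrix (Fin 2) (Fin 2) ℂ) (B : Matrix (Fin 2 × b) m ℂ) (i : Fin 2) :
    columnSlice V B i =
      star (V 0 i) • columnSlice 1 B 0 + star (V 1 i) • columnSlice 1 B 1 := by
  ext β μ
  simp [columnSlice, Fin.sum_univ_two, Matrix.one_apply]

variable [Fintype m]

theorem withAncilla_vonNeumann_apply {n : Type*} [Fintype n] [DecidableEq n]
    (V : Matrix.unitaryGroup n ℂ) (B : Matrix (n × b) m ℂ) (x y : n × b) :
    withAncilla b (vonNeumann V).channel (B * Bᴴ) x y =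
      if x.1 = y.1 then (columnSlice V.1 B x.1 * (columnSlice V.1 B x.1)ᴴ) x.2 y.2 else 0 := by
  simp only [withAncilla, Matrix.of_apply, vonNeumann_channel_apply]
  congr 1
  simp only [Matrix.mul_apply, Matrix.star_apply, Matrix.of_apply, Matrix.conjTranspose_apply,
    columnSlice, star_sum, star_mul', star_star, Finset.sum_mul, Finset.mul_sum]
  rw [Finset.sum_comm_cycle]
  exact Finset.sum_congr rfl fun μ _ => Finset.sum_congr rfl fun k _ =>
    Finset.sum_congr rfl fun l _ => by ring

variable [Fintype b]

/-- The channel output is block diagonal, so only the diagonal blocks of an effect contribute and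
the problem splits over the outcomes. -/
theorem trace_mul_withAncilla_vonNeumann {n : Type*} [Fintype n] [DecidableEq n]
    (V : Matrix.unitaryGroup n ℂ) (B : Matrix (n × b) m ℂ) (E : Matrix (n × b) (n × b) ℂ) :
    (E * withAncilla b (vonNeumann V).channel (B * Bᴴ)).trace =
      ∑ i, ((columnSlice V.1 B i)ᴴ * diagBlock E i * columnSlice V.1 B i).trace := by
  have h (i : n) : ((columnSlice V.1 B i)ᴴ * diagBlock E i * columnSlice V.1 B i).trace =
      (diagBlock E i * (columnSlice V.1 B i * (columnSlice V.1 B i)ᴴ)).trace := by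
    rw [Matrix.mul_assoc, Matrix.trace_mul_comm, Matrix.mul_assoc]
  rw [Finset.sum_congr rfl fun i _ => h i]
  simp only [Matrix.trace, Matrix.diag_apply]
  rw [Fintype.sum_prod_type]
  refine Finset.sum_congr rfl fun i _ => Finset.sum_congr rfl fun β _ => ?_
  rw [Matrix.mul_apply, Matrix.mul_apply, Fintype.sum_prod_type, Finset.sum_eq_single i]
  · simp [withAncilla_vonNeumann_apply, diagBlock]
  · intro j _ hj
    simp [withAncilla_vonNeumann_apply, hj]
  · simp

theorem sum_trace_columnSlice_one (B : Matrix (Fin 2 × b) m ℂ) :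
    ∑ i, ((columnSlice 1 B i)ᴴ * columnSlice 1 B i).trace = (B * Bᴴ).trace := by
  simp only [Matrix.trace_mul_comm _ (columnSlice 1 B _)]
  simp [Matrix.trace, Matrix.mul_apply, Fintype.sum_prod_type, columnSlice, Matrix.one_apply]

theorem sum_trace_columnSlice (U : Matrix.unitaryGroup (Fin 2) ℂ) (B : Matrix (Fin 2 × b) m ℂ) :
    ∑ i, ((columnSlice U.1 B i)ᴴ * columnSlice U.1 B i).trace = (B * Bᴴ).trace := by
  rw [← sum_trace_columnSlice_one]
  have r00 := unitary_row_mul U 0 0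
  have r01 := unitary_row_mul U 0 1
  have r10 := unitary_row_mul U 1 0
  have r11 := unitary_row_mul U 1 1
  simp only [if_true, Fin.isValue, zero_ne_one, one_ne_zero, if_false] at r00 r01 r10 r11
  simp only [Fin.sum_univ_two, columnSlice_two U.1]
  generalize columnSlice 1 B 0 = R
  generalize columnSlice 1 B 1 = S
  simp only [Matrix.conjTranspose_add, Matrix.conjTranspose_smul, star_star, Matrix.add_mul,
    Matrix.mul_add, Matrix.smul_mul, Matrix.mul_smul, Matrix.trace_add, Matrix.trace_smul,
    smul_eq_mul]
  linear_combination (Rᴴ * R).trace * r00 + (Sᴴ * S).trace * r11 + (Rᴴ * S).trace * r01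
    + (Sᴴ * R).trace * r10

/-- The off-diagonal part of `diag(φ) Uᴴ` is skew-Hermitian, so it contributes `w - star w`, which
is purely imaginary; the diagonal part is `‖U 0 0‖ • 1`. -/
theorem re_sum_phase_mul_trace (U : Matrix.unitaryGroup (Fin 2) ℂ) (B : Matrix (Fin 2 × b) m ℂ)
    {φ : Fin 2 → ℂ} (hd : ∀ i, φ i * star (U.1 i i) = (‖U.1 0 0‖ : ℂ))
    (ho : φ 1 * star (U.1 0 1) = -star (φ 0 * star (U.1 1 0))) :
    (∑ i, φ i * ((columnSlice 1 B i)ᴴ * columnSlice U.1 B i).trace).re =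
      ‖U.1 0 0‖ * (B * Bᴴ).trace.re := by
  rw [← sum_trace_columnSlice_one]
  have h0 := hd 0
  have h1 := hd 1
  simp only [Fin.sum_univ_two, columnSlice_two U.1]
  generalize columnSlice 1 B 0 = R
  generalize columnSlice 1 B 1 = S
  simp only [Matrix.mul_add, Matrix.mul_smul, Matrix.trace_add, Matrix.trace_smul, smul_eq_mul]
  have hs : (Sᴴ * R).trace = star (Rᴴ * S).trace := by
    rw [← Matrix.trace_conjTranspose]; simp
  have h : φ 0 * (star (U.1 0 0) * (Rᴴ * R).trace + star (U.1 1 0) * (Rᴴ * S).trace) +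
      φ 1 * (star (U.1 0 1) * (Sᴴ * R).trace + star (U.1 1 1) * (Sᴴ * S).trace) =
      (‖U.1 0 0‖ : ℂ) * ((Rᴴ * R).trace + (Sᴴ * S).trace)
        + (φ 0 * star (U.1 1 0) * (Rᴴ * S).trace
          - star (φ 0 * star (U.1 1 0) * (Rᴴ * S).trace)) := by
    rw [hs, star_mul' _ (Rᴴ * S).trace]
    linear_combination (Rᴴ * R).trace * h0 + (Sᴴ * S).trace * h1 + star (Rᴴ * S).trace * ho
  rw [h]
  generalize φ 0 * star (U.1 1 0) * (Rᴴ * S).trace = w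
  simp

theorem diagBlock_sum_povm {n : Type*} [Fintype n] [DecidableEq n] [DecidableEq b]
    (M : POVM (Fin 3) (n × b)) (i : n) : ∑ k, diagBlock (M.effect k) i = 1 := by
  ext β β'
  have h := congrFun (congrFun M.sum_effect (i, β)) (i, β')
  rw [Matrix.sum_apply] at h ⊢
  simpa [diagBlock, Matrix.one_apply] using h

theorem assisted_successProb_le [DecidableEq b] (U : Matrix.unitaryGroup (Fin 2) ℂ)
    {σ : Matrix (Fin 2 × b) (Fin 2 × b) ℂ} (hσ : IsDensity σ) (M : POVM (Fin 3) (Fin 2 × b))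
    (hM : IsUnambiguous (withAncilla b (vonNeumann 1).channel σ)
      (withAncilla b (vonNeumann U).channel σ) M) :
    successProb (withAncilla b (vonNeumann 1).channel σ)
      (withAncilla b (vonNeumann U).channel σ) M ≤ 1 - ‖U.1 0 0‖ := by
  obtain ⟨hpos, htr⟩ := hσ
  obtain ⟨k, B, rfl⟩ := hpos.exists_eq_mul_conjTranspose
  obtain ⟨φ, hφ, hd, ho⟩ := exists_column_phases U
  have hblock (j : Fin 3) (i : Fin 2) : (diagBlock (M.effect j) i).PosSemidef :=
    (M.posSemidef j).submatrix _
  obtain ⟨hX, hY⟩ := hM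
  unfold successProb
  rw [trace_mul_withAncilla_vonNeumann] at hX hY ⊢
  rw [trace_mul_withAncilla_vonNeumann]
  -- The block error terms are nonnegative, so each outcome is separately unambiguous.
  rw [Finset.sum_eq_zero_iff_of_nonneg
    fun i _ => ((hblock _ i).conjTranspose_mul_mul_same _).trace_nonneg] at hX hY
  have hle := Finset.sum_le_sum fun i (_ : i ∈ Finset.univ) =>
    unambiguous_pair_le (fun j => diagBlock (M.effect j) i) (fun j => hblock j i)
      (diagBlock_sum_povm M i) (columnSlice 1 B i) (columnSlice U.1 B i) (hφ i)
      (hX i (Finset.mem_univ i)) (hY i (Finset.mem_univ i))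
  simp only [Finset.sum_add_distrib, Finset.sum_sub_distrib, ← Finset.mul_sum, ← Complex.re_sum]
    at hle
  rw [re_sum_phase_mul_trace U B hd ho, sum_trace_columnSlice, sum_trace_columnSlice_one, htr]
    at hle
  simp only [Complex.one_re, mul_one] at hle
  simp only [OneMemClass.coe_one]
  linarith

end Assisted

/-! ### Attaining the assisted bound with a Bell state -/

section Attained

/-- A POVM that is block diagonal in the first factor, with rank one blocks. -/
noncomputable def rankOneBlockPOVM {ι n b : Type*} [Fintype ι] [Fintype n] [DecidableEq n]
    [Fintype b] [DecidableEq b] (c : ι → ℝ) (hc : ∀ k, 0 ≤ c k) (w : ι → n → b → ℂ)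
    (h : ∀ i, ∑ k, (c k : ℂ) • Matrix.vecMulVec (w k i) (star (w k i)) = 1) :
    POVM ι (n × b) where
  effect k := Matrix.of fun x y => if x.1 = y.1 then
    ((c k : ℂ) • Matrix.vecMulVec (w k x.1) (star (w k x.1))) x.2 y.2 else 0
  posSemidef k := by
    have hsum := Matrix.posSemidef_sum Finset.univ fun i (_ : i ∈ Finset.univ) =>
      Matrix.posSemidef_vecMulVec_self_star
        (fun x : n × b => if x.1 = i then w k i x.2 else 0)
    have hck : (0 : ℂ) ≤ (c k : ℂ) := by exact_mod_cast hc k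
    convert hsum.smul hck using 1
    ext x y
    simp only [Matrix.of_apply, Matrix.smul_apply, Matrix.sum_apply, Matrix.vecMulVec_apply,
      Pi.star_apply, smul_eq_mul]
    rw [Finset.sum_eq_single x.1]
    · by_cases hxy : x.1 = y.1 <;> simp [hxy, eq_comm]
    · intro i _ hi
      simp [hi.symm]
    · simp
  sum_effect := by
    ext x y
    have hx := congrFun (congrFun (h x.1) x.2) y.2
    rw [Matrix.sum_apply] at hx ⊢
    simp only [Matrix.of_apply]
    by_cases hxy : x.1 = y.1
    · simp [hxy, Matrix.one_apply, Prod.ext_iff] at hx ⊢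
      exact hx
    · simp [hxy, Prod.ext_iff]

theorem trace_conj_rankOne {b : Type*} [Fintype b] (X : Matrix b (Fin 1) ℂ) (c : ℂ)
    (w : b → ℂ) :
    (Xᴴ * (c • Matrix.vecMulVec w (star w)) * X).trace =
      c * ((‖∑ β, star (w β) * X β 0‖ ^ 2 : ℝ) : ℂ) := by
  rw [← star_mul_self_eq_norm_sq]
  rw [Matrix.mul_smul, Matrix.smul_mul, Matrix.trace_smul, smul_eq_mul]
  congr 1
  simp only [Matrix.trace, Matrix.diag_apply,
    Matrix.mul_apply, Matrix.vecMulVec_apply, Matrix.conjTranspose_apply, Pi.star_apply,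
    Fin.sum_univ_one, star_sum, star_mul', star_star, Finset.sum_mul,
    Finset.mul_sum]
  refine Finset.sum_congr rfl fun x _ => Finset.sum_congr rfl fun y _ => by ring

/-- The vectors supporting the three effects of the optimal assisted scheme, conditioned on the
outcome `i`. -/
noncomputable def optimalVector (U : Matrix (Fin 2) (Fin 2) ℂ) (φ : Fin 2 → ℂ) (k : Fin 3)
    (i β : Fin 2) : ℂ :=
  -- For the Bell state the conditional vectors are proportional to `e_i` and `conj u_i`. Column `0`
  -- is orthogonal to `conj u_i`, column `1` to `e_i`, and column `2` to `e_i - φ_i conj u_i`, the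
  -- equality case of `unambiguous_pair_le`.
  if β = i then ![U (1 - i) i, 0, 1 + (‖U 0 0‖ : ℂ)] k
  else ![-U i i, 1, φ i * star (U (1 - i) i)] k

/-- The weights of the three effects of the optimal assisted scheme. -/
noncomputable def optimalWeight (a : ℝ) (k : Fin 3) : ℝ :=
  -- The first two vectors are unit with overlap `a`, so their projectors sum to an operator of norm
  -- `1 + a`. The weight `1 / (1 + a)` is thus the largest possible and leaves a remainder of rank
  -- at most one.
  ![1 / (1 + a), 1 / (1 + a), a / (1 + a) ^ 2] k

theorem norm_off_diag_sq (U : Matrix.unitaryGroup (Fin 2) ℂ) (i : Fin 2) :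
    ‖U.1 (1 - i) i‖ ^ 2 = 1 - ‖U.1 0 0‖ ^ 2 := by
  fin_cases i
  · exact norm_one_zero_sq U
  · exact norm_zero_one_sq U

theorem optimal_sum_eq_one (U : Matrix.unitaryGroup (Fin 2) ℂ) {φ : Fin 2 → ℂ}
    (hφ : ∀ i, ‖φ i‖ = 1) (hd : ∀ i, φ i * star (U.1 i i) = (‖U.1 0 0‖ : ℂ)) (i : Fin 2) :
    ∑ k, (optimalWeight ‖U.1 0 0‖ k : ℂ) •
      Matrix.vecMulVec (optimalVector U.1 φ k i) (star (optimalVector U.1 φ k i)) = 1 := by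
  have ha : (1 + (‖U.1 0 0‖ : ℂ)) ≠ 0 := by
    have : (1 + ‖U.1 0 0‖ : ℝ) ≠ 0 := by positivity
    exact_mod_cast this
  have h1 : U.1 (1 - i) i * star (U.1 (1 - i) i) = 1 - (‖U.1 0 0‖ : ℂ) ^ 2 := by
    rw [mul_star_self_eq_norm_sq, norm_off_diag_sq]; push_cast; rfl
  have h2 : U.1 i i * star (U.1 i i) = (‖U.1 0 0‖ : ℂ) ^ 2 := by
    rw [mul_star_self_eq_norm_sq, norm_diag]; push_cast; rfl
  have h3 : φ i * star (φ i) = 1 := by rw [mul_star_self_eq_norm_sq, hφ]; simp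
  have h4 : star (U.1 i i) = star (φ i) * (‖U.1 0 0‖ : ℂ) := by
    linear_combination star (φ i) * hd i - star (U.1 i i) * h3
  have h5 : U.1 i i = φ i * (‖U.1 0 0‖ : ℂ) := by
    have := congrArg star h4
    simpa using this
  have hne {β : Fin 2} (h : β ≠ i) : β = 1 - i := by omega
  simp only [Complex.star_def] at h1 h2 h3 h4
  ext β β'
  simp only [Fin.sum_univ_three, Matrix.add_apply, Matrix.smul_apply, Matrix.vecMulVec_apply,
    Pi.star_apply, optimalVector, optimalWeight, smul_eq_mul, Matrix.one_apply]
  by_cases h : β = i <;> by_cases h' : β' = i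
  · subst h h'
    simp only [if_true]
    simp
    field_simp
    linear_combination h1
  · subst h
    simp only [if_true, if_neg h', if_neg (Ne.symm h')]
    simp
    field_simp
    linear_combination -U.1 (1 - β) β * h4
  · subst h'
    simp only [if_true, if_neg h]
    simp
    field_simp
    linear_combination -(starRingEnd ℂ) (U.1 (1 - β') β') * h5
  · rw [hne h, hne h']
    have h6 : 1 - i ≠ i := by omega
    simp only [if_true, if_neg h6]
    simp
    field_simp
    linear_combination (1 + (‖U.1 0 0‖ : ℂ)) * h2
      + (‖U.1 0 0‖ : ℂ) * φ i * (starRingEnd ℂ) (φ i) * h1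
      + (‖U.1 0 0‖ : ℂ) * (1 - (‖U.1 0 0‖ : ℂ) ^ 2) * h3

/-- The maximally entangled vector of two qubits, as a column matrix. -/
noncomputable def bellColumn : Matrix (Fin 2 × Fin 2) (Fin 1) ℂ :=
  Matrix.of fun x _ => if x.1 = x.2 then ((√2)⁻¹ : ℝ) else 0

theorem isDensity_bell : IsDensity (bellColumn * bellColumnᴴ) := by
  refine ⟨Matrix.posSemidef_self_mul_conjTranspose _, ?_⟩
  have h : ((√2 : ℝ) : ℂ) * (√2 : ℝ) = 2 := by
    rw [← Complex.ofReal_mul, Real.mul_self_sqrt (by norm_num)]; norm_num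
  simp only [Matrix.trace, Matrix.diag_apply, Matrix.mul_apply, Matrix.conjTranspose_apply,
    bellColumn, Matrix.of_apply, Fintype.sum_prod_type, Fin.sum_univ_two, Finset.univ_unique,
    Finset.sum_singleton]
  simp [← mul_inv, h]
  norm_num

theorem columnSlice_bell (V : Matrix (Fin 2) (Fin 2) ℂ) (i β : Fin 2) (μ : Fin 1) :
    columnSlice V bellColumn i β μ = ((√2)⁻¹ : ℝ) * star (V β i) := by
  simp [columnSlice, bellColumn, mul_comm]

theorem one_sub_norm_mem_assistedStrategyValues (U : Matrix.unitaryGroup (Fin 2) ℂ) :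
    1 - ‖U.1 0 0‖ ∈ assistedStrategyValues (vonNeumann 1) (vonNeumann U) := by
  obtain ⟨φ, hφ, hd, -⟩ := exists_column_phases U
  have hc (k : Fin 3) : 0 ≤ optimalWeight ‖U.1 0 0‖ k := by
    fin_cases k <;> simp [optimalWeight] <;> positivity
  have hpos : 0 < 1 + ‖U.1 0 0‖ := by positivity
  let M : POVM (Fin 3) (Fin 2 × Fin 2) := rankOneBlockPOVM (optimalWeight ‖U.1 0 0‖) hc
    (optimalVector U.1 φ) (optimal_sum_eq_one U hφ hd)
  have hM (k : Fin 3) (i : Fin 2) : diagBlock (M.effect k) i =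
      (optimalWeight ‖U.1 0 0‖ k : ℂ) •
        Matrix.vecMulVec (optimalVector U.1 φ k i) (star (optimalVector U.1 φ k i)) := by
    ext β β'
    simp [M, rankOneBlockPOVM, diagBlock]
  have htr (V : Matrix.unitaryGroup (Fin 2) ℂ) (k : Fin 3) :
      (M.effect k * withAncilla (Fin 2) (vonNeumann V).channel (bellColumn * bellColumnᴴ)).trace =
        ∑ i, (optimalWeight ‖U.1 0 0‖ k : ℂ) * ((1 / 2 *
          ‖∑ β, V.1 β i * optimalVector U.1 φ k i β‖ ^ 2 : ℝ) : ℂ) := by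
    rw [trace_mul_withAncilla_vonNeumann]
    refine Finset.sum_congr rfl fun i _ => ?_
    rw [hM, trace_conj_rankOne]
    congr 2
    have h : ∑ β, star (optimalVector U.1 φ k i β) * columnSlice V.1 bellColumn i β 0 =
        ((√2)⁻¹ : ℝ) * star (∑ β, V.1 β i * optimalVector U.1 φ k i β) := by
      rw [star_sum, Finset.mul_sum]
      refine Finset.sum_congr rfl fun β _ => ?_
      rw [columnSlice_bell, star_mul']
      ring
    rw [h, norm_mul, norm_star, mul_pow, Complex.norm_real, Real.norm_eq_abs, sq_abs, inv_pow,
      Real.sq_sqrt (by norm_num), one_div]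
  refine ⟨2, bellColumn * bellColumnᴴ, isDensity_bell, M, ⟨?_, ?_⟩, ?_⟩
  · rw [htr]
    simp [Fin.sum_univ_two, optimalVector, Matrix.one_apply]
  · rw [htr]
    simp [Fin.sum_univ_two, optimalVector, mul_comm]
  · unfold successProb
    rw [htr, htr]
    simp only [← Complex.ofReal_mul, ← Complex.ofReal_sum, Complex.ofReal_re]
    have h0 := norm_one_zero_sq U
    have h1 := norm_zero_one_sq U
    simp [Fin.sum_univ_two, optimalVector, optimalWeight, Matrix.one_apply]
    rw [h0, h1]
    field_simp
    ring

theorem isGreatest_assisted (U : Matrix.unitaryGroup (Fin 2) ℂ) :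
    IsGreatest (assistedStrategyValues (vonNeumann 1) (vonNeumann U)) (1 - ‖U.1 0 0‖) := by
  refine ⟨one_sub_norm_mem_assistedStrategyValues U, ?_⟩
  rintro _ ⟨d, σ, hσ, M, hM, rfl⟩
  exact assisted_successProb_le U hσ M hM

end Attained

/-! ### The scheme without entanglement -/

section Unassisted

theorem trace_mul_vonNeumann_channel {n : Type*} [Fintype n] [DecidableEq n]
    (V : Matrix.unitaryGroup n ℂ) (E σ : Matrix n n ℂ) :
    (E * (vonNeumann V).channel σ).trace = ∑ i, E i i * (star V.1 * σ * V.1) i i := by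
  refine Finset.sum_congr rfl fun i _ => ?_
  rw [Matrix.diag_apply, Matrix.mul_apply, Finset.sum_eq_single i]
  · rw [vonNeumann_channel_apply, if_pos rfl]
  · intro j _ hj
    rw [vonNeumann_channel_apply, if_neg hj, mul_zero]
  · simp

/-- A zero diagonal entry of a positive matrix kills its row and column, so `σ` is the other basis
projector. -/
theorem conj_diag_eq_of_diag_eq_zero {σ : Matrix (Fin 2) (Fin 2) ℂ} (hσ : IsDensity σ)
    (V : Matrix (Fin 2) (Fin 2) ℂ) {i : Fin 2} (hi : σ i i = 0) :
    (star V * σ * V) i i = ((‖V (1 - i) i‖ ^ 2 : ℝ) : ℂ) := by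
  obtain ⟨hpos, htr⟩ := hσ
  have hcol : σ *ᵥ Pi.single i 1 = 0 := by
    rw [← hpos.dotProduct_mulVec_zero_iff]
    simp [hi]
  have hc (j : Fin 2) : σ j i = 0 := by simpa using congrFun hcol j
  have hr (j : Fin 2) : σ i j = 0 := by rw [← hpos.isHermitian.apply, hc, star_zero]
  rw [← star_mul_self_eq_norm_sq]
  simp only [Matrix.trace, Matrix.diag_apply, Fin.sum_univ_two] at htr
  fin_cases i <;> simp_all [Matrix.mul_apply, Fin.sum_univ_two]

theorem isDensity_conj {n : Type*} [Fintype n] [DecidableEq n] (U : Matrix.unitaryGroup n ℂ)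
    {σ : Matrix n n ℂ} (hσ : IsDensity σ) : IsDensity (star U.1 * σ * U.1) := by
  refine ⟨hσ.1.conjTranspose_mul_mul_same U.1, ?_⟩
  rw [Matrix.mul_assoc, Matrix.trace_mul_comm, Matrix.mul_assoc,
    Matrix.mem_unitaryGroup_iff.mp U.2, Matrix.mul_one, hσ.2]

/-- A point where both `p` and `q` are nonzero contributes nothing; any other contributes at most
`s`. A zero at one point puts mass `1` on the other, which excludes a second zero because `s < 1`.
-/
theorem classical_unambiguous_le {p q : Fin 2 → ℝ} {e : Fin 3 → Fin 2 → ℝ} {s : ℝ}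
    (hs : s < 1) (hs0 : 0 ≤ s) (he : ∀ k i, 0 ≤ e k i) (hsum : ∀ i, ∑ k, e k i = 1)
    (hp : ∑ i, p i = 1) (hq : ∑ i, q i = 1)
    (hep : ∀ i, e 1 i * p i = 0) (heq : ∀ i, e 0 i * q i = 0)
    (hpq : ∀ i, p i = 0 → q i = s) (hqp : ∀ i, q i = 0 → p i = s) :
    ∑ i, (e 0 i * p i + e 1 i * q i) ≤ s := by
  have hle (k : Fin 3) (i : Fin 2) : e k i ≤ 1 := by
    rw [← hsum i]
    exact Finset.single_le_sum (f := fun k => e k i) (fun k _ => he k i) (Finset.mem_univ k)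
  have hzero (i : Fin 2) (h : p i ≠ 0) (h' : q i ≠ 0) : e 0 i * p i + e 1 i * q i = 0 := by
    rw [(mul_eq_zero.mp (hep i)).resolve_right h, (mul_eq_zero.mp (heq i)).resolve_right h']
    simp
  have hbound (i : Fin 2) (h : p i = 0 ∨ q i = 0) : e 0 i * p i + e 1 i * q i ≤ s := by
    rcases h with h | h
    · rw [h, hpq i h]; nlinarith [hle 1 i]
    · rw [h, hqp i h]; nlinarith [hle 0 i]
  rw [Fin.sum_univ_two] at hp hq ⊢
  by_cases h0 : p 0 = 0 ∨ q 0 = 0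
  · have h1 : p 1 ≠ 0 ∧ q 1 ≠ 0 := by
      rcases h0 with h0 | h0
      · have hp1 : p 1 = 1 := by linarith
        exact ⟨by rw [hp1]; exact one_ne_zero, fun h => hs.ne (by rw [← hqp 1 h, hp1])⟩
      · have hq1 : q 1 = 1 := by linarith
        exact ⟨fun h => hs.ne (by rw [← hpq 1 h, hq1]), by rw [hq1]; exact one_ne_zero⟩
    rw [hzero 1 h1.1 h1.2, add_zero]
    exact hbound 0 h0
  · rw [not_or] at h0
    rw [hzero 0 h0.1 h0.2, zero_add]
    by_cases h1 : p 1 = 0 ∨ q 1 = 0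
    · exact hbound 1 h1
    · rw [not_or] at h1
      rw [hzero 1 h1.1 h1.2]
      exact hs0

theorem norm_off_diag_sq_eq (U : Matrix.unitaryGroup (Fin 2) ℂ) (i : Fin 2) :
    ‖U.1 (1 - i) i‖ ^ 2 = ‖U.1 0 1‖ ^ 2 := by
  rw [norm_off_diag_sq, norm_zero_one_sq]

theorem _root_.Matrix.PosSemidef.exists_real_diag {n : Type*} [Fintype n] {A : Matrix n n ℂ}
    (h : A.PosSemidef) : ∃ p : n → ℝ, (∀ i, 0 ≤ p i) ∧ ∀ i, A i i = (p i : ℂ) :=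
  ⟨fun i => (A i i).re, fun _ => (Complex.nonneg_iff.mp h.diag_nonneg).1,
    fun _ => Complex.eq_re_of_ofReal_le h.diag_nonneg⟩

theorem IsDensity.exists_real_diag {n : Type*} [Fintype n] {A : Matrix n n ℂ}
    (h : IsDensity A) :
    ∃ p : n → ℝ, (∀ i, 0 ≤ p i) ∧ (∀ i, A i i = (p i : ℂ)) ∧ ∑ i, p i = 1 := by
  obtain ⟨p, hp, hA⟩ := h.1.exists_real_diag
  refine ⟨p, hp, hA, ?_⟩
  have htr := h.2
  simp only [Matrix.trace, Matrix.diag_apply, hA] at htr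
  exact_mod_cast htr

/-- Without entanglement, a strategy reduces to the discrimination of two probability
distributions `p` and `q` by a classical test `e`. -/
theorem exists_classical_strategy (U : Matrix.unitaryGroup (Fin 2) ℂ)
    {σ : Matrix (Fin 2) (Fin 2) ℂ} (hσ : IsDensity σ) (M : POVM (Fin 3) (Fin 2))
    (hM : IsUnambiguous ((vonNeumann 1).channel σ) ((vonNeumann U).channel σ) M) :
    ∃ (p q : Fin 2 → ℝ) (e : Fin 3 → Fin 2 → ℝ),
      (∀ k i, 0 ≤ e k i) ∧ (∀ i, ∑ k, e k i = 1) ∧ ∑ i, p i = 1 ∧ ∑ i, q i = 1 ∧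
      (∀ i, 0 ≤ p i) ∧ (∀ i, 0 ≤ q i) ∧
      (∀ i, e 1 i * p i = 0) ∧ (∀ i, e 0 i * q i = 0) ∧
      (∀ i, p i = 0 → q i = ‖U.1 0 1‖ ^ 2) ∧ (∀ i, q i = 0 → p i = ‖U.1 0 1‖ ^ 2) ∧
      successProb ((vonNeumann 1).channel σ) ((vonNeumann U).channel σ) M =
        1 / 2 * ∑ i, (e 0 i * p i + e 1 i * q i) := by
  have hτ := isDensity_conj U hσ
  -- Conjugating back by `star U` exchanges the roles of the two measurements, so the zero-diagonal
  -- lemma also covers `q i = 0`.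
  have hback : star (star U.1) * (star U.1 * σ * U.1) * star U.1 = σ := by
    have h : U.1 * star U.1 = 1 := Matrix.mem_unitaryGroup_iff.mp U.2
    rw [star_star, Matrix.mul_assoc, Matrix.mul_assoc, h, Matrix.mul_one, ← Matrix.mul_assoc, h,
      Matrix.one_mul]
  obtain ⟨hX, hY⟩ := hM
  unfold successProb
  rw [trace_mul_vonNeumann_channel] at hX hY ⊢
  rw [trace_mul_vonNeumann_channel]
  have hone : star (1 : Matrix.unitaryGroup (Fin 2) ℂ).1 * σ *
      (1 : Matrix.unitaryGroup (Fin 2) ℂ).1 = σ := by simp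
  rw [hone] at hX ⊢
  have hqs (i : Fin 2) (h : σ i i = 0) :
      (star U.1 * σ * U.1) i i = ((‖U.1 0 1‖ ^ 2 : ℝ) : ℂ) := by
    rw [conj_diag_eq_of_diag_eq_zero hσ U.1 h, norm_off_diag_sq_eq]
  have hps (i : Fin 2) (h : (star U.1 * σ * U.1) i i = 0) :
      σ i i = ((‖U.1 0 1‖ ^ 2 : ℝ) : ℂ) := by
    have h' := conj_diag_eq_of_diag_eq_zero hτ (star U.1) h
    rw [hback, Matrix.star_apply, norm_star] at h'
    rw [h', ← norm_off_diag_sq_eq U (1 - i), sub_sub_cancel]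
  obtain ⟨p, hp, hσp, hp1⟩ := hσ.exists_real_diag
  obtain ⟨q, hq, hτq, hq1⟩ := hτ.exists_real_diag
  choose e he hMe using fun k => (M.posSemidef k).exists_real_diag
  simp only [hMe, hσp, hτq, ← Complex.ofReal_mul, ← Complex.ofReal_sum, Complex.ofReal_re,
    Complex.ofReal_eq_zero, Complex.ofReal_inj] at hX hY hqs hps ⊢
  rw [Finset.sum_eq_zero_iff_of_nonneg fun i _ => mul_nonneg (he _ i) (hp i)] at hX
  rw [Finset.sum_eq_zero_iff_of_nonneg fun i _ => mul_nonneg (he _ i) (hq i)] at hY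
  refine ⟨p, q, e, he, fun i => ?_, hp1, hq1, hp, hq, fun i => hX i (Finset.mem_univ i),
    fun i => hY i (Finset.mem_univ i), hqs, hps, by rw [Finset.sum_add_distrib]⟩
  have h := congrFun (congrFun M.sum_effect i) i
  simp only [Matrix.sum_apply, hMe, Matrix.one_apply_eq] at h
  exact_mod_cast h

/-- A POVM with effects diagonal in the standard basis. -/
noncomputable def diagonalPOVM {ι n : Type*} [Fintype ι] [Fintype n] [DecidableEq n]
    (e : ι → n → ℝ) (he : ∀ k i, 0 ≤ e k i) (hsum : ∀ i, ∑ k, e k i = 1) : POVM ι n where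
  effect k := Matrix.diagonal fun i => (e k i : ℂ)
  posSemidef k := Matrix.PosSemidef.diagonal fun i => by
    simpa using he k i
  sum_effect := by
    ext i j
    rw [Matrix.sum_apply]
    by_cases hij : i = j
    · subst hij
      simp only [Matrix.diagonal_apply_eq, Matrix.one_apply_eq]
      exact_mod_cast hsum i
    · simp [hij]

theorem isDensity_single {n : Type*} [Fintype n] [DecidableEq n] (i : n) :
    IsDensity (Matrix.single i i (1 : ℂ)) := by
  refine ⟨?_, by simp⟩
  have h := Matrix.posSemidef_vecMulVec_self_star (Pi.single i (1 : ℂ))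
  convert h using 1
  ext j k
  simp [Matrix.single_apply, Matrix.vecMulVec_apply, Pi.single_apply, ite_and, eq_comm]
  split_ifs <;> rfl

theorem trace_diagonalPOVM_mul {ι n : Type*} [Fintype ι] [Fintype n] [DecidableEq n]
    (e : ι → n → ℝ) (he : ∀ k i, 0 ≤ e k i) (hsum : ∀ i, ∑ k, e k i = 1)
    (V : Matrix.unitaryGroup n ℂ) (k : ι) (j : n) :
    ((diagonalPOVM e he hsum).effect k * (vonNeumann V).channel (Matrix.single j j 1)).trace =
      ((∑ i, e k i * ‖V.1 j i‖ ^ 2 : ℝ) : ℂ) := by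
  rw [trace_mul_vonNeumann_channel, Complex.ofReal_sum]
  refine Finset.sum_congr rfl fun i _ => ?_
  rw [Complex.ofReal_mul, ← star_mul_self_eq_norm_sq]
  simp [diagonalPOVM, Matrix.mul_apply, Matrix.single_apply, ite_and]

theorem isGreatest_unassisted (U : Matrix.unitaryGroup (Fin 2) ℂ) :
    IsGreatest (strategyValues (vonNeumann 1) (vonNeumann U))
      (if ‖U.1 0 1‖ ^ 2 = 1 then 1 else 1 / 2 * ‖U.1 0 1‖ ^ 2) := by
  constructor
  · split_ifs with hU
    · have h1 : ‖U.1 0 0‖ = 0 := by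
        have := norm_zero_one_sq U
        exact pow_eq_zero_iff two_ne_zero |>.mp (by linarith)
      -- Here `U` is antidiagonal, so on input `|0⟩` the outcome identifies the measurement.
      refine ⟨Matrix.single 0 0 1, isDensity_single 0,
        diagonalPOVM ![![1, 0], ![0, 1], ![0, 0]] ?_ ?_, ⟨?_, ?_⟩, ?_⟩
      · intro k i; fin_cases k <;> fin_cases i <;> simp
      · intro i; fin_cases i <;> simp [Fin.sum_univ_three]
      · rw [trace_diagonalPOVM_mul]; simp [Fin.sum_univ_two]
      · rw [trace_diagonalPOVM_mul]; simp [Fin.sum_univ_two, h1]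
      · rw [successProb, trace_diagonalPOVM_mul, trace_diagonalPOVM_mul]
        simp only [Complex.ofReal_re]
        simp [Fin.sum_univ_two, hU]
        norm_num
    -- On input `|0⟩` the standard measurement never yields outcome `1`, which therefore certifies
    -- `U`; outcome `0` is declared inconclusive.
    · refine ⟨Matrix.single 0 0 1, isDensity_single 0,
        diagonalPOVM ![![0, 0], ![0, 1], ![1, 0]] ?_ ?_, ⟨?_, ?_⟩, ?_⟩
      · intro k i; fin_cases k <;> fin_cases i <;> simp
      · intro i; fin_cases i <;> simp [Fin.sum_univ_three]
      · rw [trace_diagonalPOVM_mul]; simp [Fin.sum_univ_two]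
      · rw [trace_diagonalPOVM_mul]; simp [Fin.sum_univ_two]
      · rw [successProb, trace_diagonalPOVM_mul, trace_diagonalPOVM_mul]
        simp only [Complex.ofReal_re]
        simp [Fin.sum_univ_two]
  · rintro _ ⟨σ, hσ, M, hM, rfl⟩
    obtain ⟨p, q, e, he, hsum, hp1, hq1, hp, hq, hep, heq, hpq, hqp, hval⟩ :=
      exists_classical_strategy U hσ M hM
    rw [hval]
    split_ifs with hU
    · have hle (k : Fin 3) (i : Fin 2) : e k i ≤ 1 := by
        rw [← hsum i]
        exact Finset.single_le_sum (f := fun k => e k i) (fun k _ => he k i) (Finset.mem_univ k)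
      have h : ∑ i, (e 0 i * p i + e 1 i * q i) ≤ ∑ i, (p i + q i) :=
        Finset.sum_le_sum fun i _ => add_le_add (mul_le_of_le_one_left (hp i) (hle 0 i))
          (mul_le_of_le_one_left (hq i) (hle 1 i))
      rw [Finset.sum_add_distrib (f := p), hp1, hq1] at h
      linarith
    · have hlt : ‖U.1 0 1‖ ^ 2 < 1 := by
        refine lt_of_le_of_ne ?_ hU
        rw [norm_zero_one_sq]
        linarith [sq_nonneg ‖U.1 0 0‖]
      exact mul_le_mul_of_nonneg_left (classical_unambiguous_le hlt (sq_nonneg _) he hsum hp1 hq1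
        hep heq hpq hqp) (by norm_num)

end Unassisted
end UnambiguousDiscrimination

/-! ### Comparison of the two optimal values -/

theorem mainTheorem9 (U : Matrix.unitaryGroup (Fin 2) ℂ) :
    -- both optimal probabilities are maxima
    IsGreatest
      (UnambiguousDiscrimination.strategyValues
        (UnambiguousDiscrimination.vonNeumann 1) (UnambiguousDiscrimination.vonNeumann U))
      (UnambiguousDiscrimination.optProb
        (UnambiguousDiscrimination.vonNeumann 1) (UnambiguousDiscrimination.vonNeumann U)) ∧
    IsGreatest
      (UnambiguousDiscrimination.assistedStrategyValues
        (UnambiguousDiscrimination.vonNeumann 1) (UnambiguousDiscrimination.vonNeumann U))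
      (UnambiguousDiscrimination.optProbAssisted
        (UnambiguousDiscrimination.vonNeumann 1) (UnambiguousDiscrimination.vonNeumann U)) ∧
    -- the value without entanglement
    UnambiguousDiscrimination.optProb
        (UnambiguousDiscrimination.vonNeumann 1) (UnambiguousDiscrimination.vonNeumann U) =
      (if ‖U.1 0 1‖ ^ 2 = 1 then 1 else 1 / 2 * ‖U.1 0 1‖ ^ 2) ∧
    (‖U.1 0 0‖ ∉ ({0, 1} : Set ℝ) →
      UnambiguousDiscrimination.optProbAssisted
          (UnambiguousDiscrimination.vonNeumann 1) (UnambiguousDiscrimination.vonNeumann U) =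
        1 - ‖U.1 0 0‖ ∧
      UnambiguousDiscrimination.optProb
          (UnambiguousDiscrimination.vonNeumann 1) (UnambiguousDiscrimination.vonNeumann U) <
        UnambiguousDiscrimination.optProbAssisted
          (UnambiguousDiscrimination.vonNeumann 1) (UnambiguousDiscrimination.vonNeumann U)) ∧
    (‖U.1 0 0‖ ∈ ({0, 1} : Set ℝ) →
      UnambiguousDiscrimination.optProbAssisted
          (UnambiguousDiscrimination.vonNeumann 1) (UnambiguousDiscrimination.vonNeumann U) =
        UnambiguousDiscrimination.optProb
          (UnambiguousDiscrimination.vonNeumann 1) (UnambiguousDiscrimination.vonNeumann U)) := by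
  have hu := UnambiguousDiscrimination.isGreatest_unassisted U
  have he := UnambiguousDiscrimination.isGreatest_assisted U
  have hs := UnambiguousDiscrimination.norm_zero_one_sq U
  have h1 := UnambiguousDiscrimination.norm_zero_zero_le_one U
  have h0 := norm_nonneg (U.1 0 0)
  rw [UnambiguousDiscrimination.optProb, UnambiguousDiscrimination.optProbAssisted,
    hu.csSup_eq, he.csSup_eq]
  refine ⟨hu, he, rfl, fun h => ⟨rfl, ?_⟩, fun h => ?_⟩
  · simp only [Set.mem_insert_iff, Set.mem_singleton_iff, not_or] at h
    have hpos := lt_of_le_of_ne h0 (Ne.symm h.1)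
    have hlt := lt_of_le_of_ne h1 h.2
    -- `a > 0` excludes the exceptional value `1`; the gap is then `(1 - a) - (1 - a²) / 2 = (1 -
    -- a)² / 2`, positive since `a < 1`.
    rw [hs, if_neg (by nlinarith)]
    nlinarith
  · rw [hs]
    rcases h with h | h
    · rw [h]; norm_num
    · rw [Set.mem_singleton_iff.mp h]; norm_num
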